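/- Let $t\ge 0$ and $k\ge 2t$ be fixed integers. Let $V$ be a finite set with $v=|V|\ge 2t$. For $0\le i\le t$ put $\xi_i=\binom{v-t-i}{k-t-i}$, and let $M$ be the real matrix, with rows and columns indexed by the $t$-element subsets of $V$, given by $M(T,U)=\xi_{|T\setminus U|}$. For $0\le i,j\le t$ let $$P_{ij}=\sum_{s=0}^{i}(-1)^{i-s}\binom{t-s}{i-s}\binom{t-j}{s}\binom{v-t+s-j}{s}$$ (the entries of the first eigenmatrix of the Johnson scheme $J(t,v)$), and put $$\theta_j=\sum_{i=0}^{t}\xi_iP_{ij},\qquad m_j=\binom{v}{j}-\binom{v}{j-1},$$ where $\binom{v}{-1}=0$. (1) The eigenvalues of $M$ are exactly $\theta_0,\dots,\theta_t$, each $\theta_j$ with multiplicity $m_j$. That is, the characteristic polynomial of $M$ is $\prod_{j=0}^{t}(x-\theta_j)^{m_j}$, and for every real $\mu$ the space $\ker(M-\mu I)$ has dimension $\sum_{j:\theta_j=\mu}m_j$. (2) For each fixed $j$ with $0\le j\le t$, as $v\to\infty$, $$\theta_j=\binom{k-j}{t-j}\frac{v^{k-t}}{(k-t)!}+o(v^{k-t}),$$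 and $\theta_j$ has exact order $v^{k-t}$, i.e. $\theta_j=\Theta(v^{k-t})$. (3) There is $v_0$, depending only on $t$ and $k$, such that for all $v\ge v_0$ we have $\theta_0>\theta_1>\dots>\theta_t$. In particular the $\theta_j$ are then distinct reals, the eigenspace of $\theta_j$ has dimension exactly $m_j$, and $\theta_t$ is the least eigenvalue of $M$. -/

import Mathlib

namespace JohnsonCoverage

/-- The numbers `ξ_i = binom (v - t - i) (k - t - i)`, used only for `i ≤ t`, `2 t ≤ k`, `2 t ≤ v`,
where no subtraction truncates. -/
def xi (v t k i : ℕ) : ℕ := (v - t - i).choose (k - t - i)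

/-- The `t`-element subsets of `V`. -/
abbrev TSubset (V : Type*) (t : ℕ) : Type _ := {T : Finset V // T.card = t}

/-- The real matrix `M`, indexed by the `t`-subsets of the finite set `V`, with entries
`M(T, U) = ξ_{|T \ U|}` where `v = |V|`. -/
def coverageMatrix (V : Type*) [Fintype V] [DecidableEq V] (t k : ℕ) :
    Matrix (TSubset V t) (TSubset V t) ℝ :=
  Matrix.of fun T U => (xi (Fintype.card V) t k (T.1 \ U.1).card : ℝ)

/-- The entries `P_{ij}` of the first eigenmatrix of the Johnson scheme `J(t, v)`,
used only for `i, j ≤ t` and `2 t ≤ v`, where no subtraction truncates. -/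
def eigenP (v t i j : ℕ) : ℝ :=
  ∑ s ∈ Finset.range (i + 1), (-1 : ℝ) ^ (i - s) * ((t - s).choose (i - s) : ℝ) *
    ((t - j).choose s : ℝ) * ((v - t + s - j).choose s : ℝ)

/-- `θ_j = ∑_{i=0}^t ξ_i P_{ij}`. -/
def theta (v t k j : ℕ) : ℝ :=
  ∑ i ∈ Finset.range (t + 1), (xi v t k i : ℝ) * eigenP v t i j

/-- `m_j = binom v j - binom v (j - 1)`, with `binom v (-1) = 0`. For `j ≤ t` and `2 t ≤ v`
the difference is positive, so the subtraction of natural numbers is the ordinary one. -/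
def multiplicity (v j : ℕ) : ℕ :=
  v.choose j - (if j = 0 then 0 else v.choose (j - 1))

end JohnsonCoverage

namespace JohnsonCoverage

open Finset hiding mem_antidiagonal
open Finset.HasAntidiagonal Matrix


/-! Write W_{a,b} for `inclusionMatrix V a b`. By Vandermonde (`inclusionMatrix_mul_transpose`),
W_{r,n} W_{j,n}ᵀ is a combination of the W_{a,r}ᵀ W_{a,j}; on a harmonic function on j-subsets only
a = j survives. So moving a lifted harmonic function between levels only rescales it.

Two formulas for M then give its eigenvalue on these lifts twice. Binomial inversion writes M
through the W_{t-s,t}ᵀ W_{t-s,t} and yields θ_j for all v ≥ 2t. For k ≤ v, M = W_{t,k} W_{t,k}ᵀ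
yields C(k-j,k-t) C(v-t-j,k-t). Equating them gives `theta_eq`, from which the order and the
asymptotics of the θ_j are read off.

For multiplicities, rank-nullity gives at least m_j independent harmonic functions. Lifts from
different j are separated by the distinct eigenvalues of W_{t-1,t}ᵀ W_{t-1,t}, and the m_j sum to
C(v,t), so the lifts contain an eigenbasis (`exists_eigenbasis`), even where some θ_j coincide. -/

/-! ### Inclusion matrices and their products -/

/-- The inclusion matrix of `a`-subsets versus `b`-subsets of `V`. -/
def inclusionMatrix (V : Type*) [DecidableEq V] (a b : ℕ) :
    Matrix (TSubset V a) (TSubset V b) ℝ :=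
  Matrix.of fun S T => if S.1 ⊆ T.1 then 1 else 0

theorem card_tSubset (V : Type*) [Fintype V] (a : ℕ) :
    Fintype.card (TSubset V a) = (Fintype.card V).choose a := by
  simp

theorem sum_tSubset_ite {V : Type*} [Fintype V] (p : Finset V → Prop) [DecidablePred p] (n : ℕ) :
    ∑ U : TSubset V n, (if p U.1 then (1 : ℝ) else 0) =
      (((univ : Finset V).powersetCard n).filter p).card := by
  rw [Finset.card_filter, Nat.cast_sum]
  simp only [Nat.cast_ite, Nat.cast_one, Nat.cast_zero]
  exact (Finset.sum_subtype (powersetCard n univ) (fun x => by simp)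
    (fun U => if p U then (1 : ℝ) else 0)).symm

theorem inclusionMatrix_self {V : Type*} [DecidableEq V] (j : ℕ) : inclusionMatrix V j j = 1 := by
  ext S T
  simp only [inclusionMatrix, of_apply, one_apply]
  congr 1
  refine propext ⟨fun h => Subtype.ext (eq_of_subset_of_card_le h (by rw [S.2, T.2])), ?_⟩
  rintro rfl
  rfl

theorem inclusionMatrix_eq_zero {V : Type*} [DecidableEq V] {a j : ℕ} (h : j < a) : inclusionMatrix V a j = 0 := by
  ext S T
  simp only [inclusionMatrix, of_apply, Matrix.zero_apply, ite_eq_right_iff]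
  intro hST
  have := card_le_card hST
  rw [S.2, T.2] at this
  omega

variable {V : Type*} [Fintype V] [DecidableEq V]

/-- Counting the elements of T left out, rather than those added to S, makes the binomial vanish by
itself when n < |S|. -/
theorem card_filter_Icc (S T : Finset V) (n : ℕ) (hST : S ⊆ T) (hn : n ≤ T.card) :
    (((univ : Finset V).powersetCard n).filter (fun U => S ⊆ U ∧ U ⊆ T)).card =
      (T.card - S.card).choose (T.card - n) := by
  have h : ((univ : Finset V).powersetCard n).filter (fun U => S ⊆ U ∧ U ⊆ T) =
      (T.powersetCard n).filter (S ⊆ ·) := by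
    ext U; simp only [mem_filter, mem_powersetCard, subset_univ, true_and]; tauto
  rw [h]
  by_cases hS : S.card ≤ n
  · rw [card_filter_powersetCard_subset _ _ _ hST hS]
    apply Nat.choose_symm_of_eq_add
    omega
  · rw [Nat.choose_eq_zero_of_lt (by have := card_le_card hST; omega), card_eq_zero,
      filter_eq_empty_iff]
    intro U hU hSU
    have := card_le_card hSU
    rw [mem_powersetCard] at hU
    omega

theorem inclusionMatrix_mul (a r b : ℕ) (h : r ≤ b) :
    inclusionMatrix V a r * inclusionMatrix V r b =
      ((b - a).choose (b - r) : ℝ) • inclusionMatrix V a b := by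
  ext S T
  simp only [inclusionMatrix, mul_apply, Matrix.smul_apply, of_apply, smul_eq_mul, mul_ite, mul_one,
    mul_zero, ← ite_and]
  rw [show ∑ U : TSubset V r, (if U.1 ⊆ T.1 ∧ S.1 ⊆ U.1 then (1 : ℝ) else 0) = _ from
    sum_tSubset_ite (fun U => U ⊆ T.1 ∧ S.1 ⊆ U) r]
  split_ifs with hST
  · have := card_filter_Icc S.1 T.1 r hST (by rw [T.2]; exact h)
    rw [S.2, T.2] at this
    rw [← this]
    simp only [and_comm]
  · rw [Nat.cast_eq_zero, card_eq_zero, filter_eq_empty_iff]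
    rintro U - ⟨h1, h2⟩
    exact hST (h2.trans h1)

theorem inclusionMatrix_mul_transpose_apply (r j n : ℕ) (hn : n ≤ Fintype.card V)
    (R : TSubset V r) (S : TSubset V j) :
    (inclusionMatrix V r n * (inclusionMatrix V j n)ᵀ) R S =
      ((Fintype.card V - (R.1 ∪ S.1).card).choose (Fintype.card V - n) : ℝ) := by
  simp only [inclusionMatrix, mul_apply, of_apply, transpose_apply, mul_ite, mul_one,
    mul_zero, ← ite_and]
  rw [show ∑ U : TSubset V n, (if S.1 ⊆ U.1 ∧ R.1 ⊆ U.1 then (1 : ℝ) else 0) = _ from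
    sum_tSubset_ite (fun U => S.1 ⊆ U ∧ R.1 ⊆ U) n]
  have := card_filter_Icc (R.1 ∪ S.1) univ n (subset_univ _) (by simpa using hn)
  rw [card_univ] at this
  rw [← this]
  simp only [union_subset_iff, subset_univ, and_true]
  simp only [and_comm]

theorem transpose_inclusionMatrix_mul_apply (a r j : ℕ) (R : TSubset V r) (S : TSubset V j) :
    ((inclusionMatrix V a r)ᵀ * inclusionMatrix V a j) R S = ((R.1 ∩ S.1).card.choose a : ℝ) := by
  simp only [inclusionMatrix, mul_apply, of_apply, transpose_apply, mul_ite, mul_one,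
    mul_zero, ← ite_and]
  rw [show ∑ U : TSubset V a, (if U.1 ⊆ S.1 ∧ U.1 ⊆ R.1 then (1 : ℝ) else 0) = _ from
    sum_tSubset_ite (fun U => U ⊆ S.1 ∧ U ⊆ R.1) a]
  rw [← card_powersetCard]
  congr 2
  ext U
  simp only [mem_filter, mem_powersetCard, subset_univ, true_and, subset_inter_iff]
  tauto

/-- Vandermonde applied to v - |R ∪ S| = |R ∩ S| + (v - r - j). It trades going up and then down for
going down and then up. -/
theorem inclusionMatrix_mul_transpose (r j n : ℕ) (hn : n ≤ Fintype.card V)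
    (hrj : r + j ≤ Fintype.card V) :
    inclusionMatrix V r n * (inclusionMatrix V j n)ᵀ =
      ∑ p ∈ antidiagonal (Fintype.card V - n), ((Fintype.card V - r - j).choose p.2 : ℝ) •
        ((inclusionMatrix V p.1 r)ᵀ * inclusionMatrix V p.1 j) := by
  ext R S
  rw [inclusionMatrix_mul_transpose_apply r j n hn, Matrix.sum_apply]
  simp only [Matrix.smul_apply, transpose_inclusionMatrix_mul_apply, smul_eq_mul]
  have hc := card_union_add_card_inter R.1 S.1
  rw [R.2, S.2] at hc
  rw [show Fintype.card V - (R.1 ∪ S.1).card =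
    (R.1 ∩ S.1).card + (Fintype.card V - r - j) by omega, Nat.add_choose_eq, Nat.cast_sum]
  refine sum_congr rfl fun p _ => ?_
  push_cast
  ring

/-! ### Harmonic functions and their lifts -/

/-- The functions on `j`-subsets of `V` whose sum over the `j`-subsets containing a given smaller
set vanishes. -/
def harmonic (V : Type*) [Fintype V] [DecidableEq V] (j : ℕ) : Submodule ℝ (TSubset V j → ℝ) :=
  ⨅ a : Fin j, LinearMap.ker (inclusionMatrix V a j).mulVecLin

theorem mem_harmonic {j : ℕ} {f : TSubset V j → ℝ} :
    f ∈ harmonic V j ↔ ∀ a < j, inclusionMatrix V a j *ᵥ f = 0 := by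
  simp only [harmonic, Submodule.mem_iInf, LinearMap.mem_ker, mulVecLin_apply]
  exact ⟨fun h a ha => h ⟨a, ha⟩, fun h a => h a a.2⟩

/-- Up to nonzero scalars, all downward maps factor through the one to the next lower level, so
rank-nullity for that single map suffices. The lower bound is enough for the later dimension count.
-/
theorem multiplicity_le_finrank_harmonic (j : ℕ) :
    multiplicity (Fintype.card V) j ≤ Module.finrank ℝ (harmonic V j) := by
  cases j with
  | zero =>
    have : harmonic V 0 = ⊤ := by
      rw [eq_top_iff]
      intro f _
      rw [mem_harmonic]
      intro a ha
      omega
    rw [this, finrank_top, Module.finrank_fintype_fun_eq_card, card_tSubset]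
    simp [multiplicity]
  | succ j =>
    have hle : LinearMap.ker (inclusionMatrix V j (j + 1)).mulVecLin ≤ harmonic V (j + 1) := by
      intro f hf
      rw [LinearMap.mem_ker, mulVecLin_apply] at hf
      rw [mem_harmonic]
      intro a ha
      have h := congrArg (· *ᵥ f) (inclusionMatrix_mul (V := V) a j (j + 1) (Nat.le_succ j))
      simp only [← mulVec_mulVec, hf, mulVec_zero, smul_mulVec] at h
      refine (smul_eq_zero.mp h.symm).resolve_left ?_
      exact Nat.cast_ne_zero.mpr (Nat.choose_pos (by omega)).ne'
    refine le_trans ?_ (Submodule.finrank_mono hle)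
    have h1 := LinearMap.finrank_range_add_finrank_ker (inclusionMatrix V j (j + 1)).mulVecLin
    have h2 := Submodule.finrank_le (LinearMap.range (inclusionMatrix V j (j + 1)).mulVecLin)
    rw [Module.finrank_fintype_fun_eq_card, card_tSubset] at h1 h2
    simp only [multiplicity, Nat.add_one_ne_zero, if_false, Nat.add_sub_cancel]
    omega

theorem inclusionMatrix_mulVec_harmonic {r j n : ℕ} (hrn : r ≤ n) (hn : n ≤ Fintype.card V)
    (hrj : r + j ≤ Fintype.card V) {f : TSubset V j → ℝ} (hf : f ∈ harmonic V j) :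
    inclusionMatrix V r n *ᵥ ((inclusionMatrix V j n)ᵀ *ᵥ f) =
      ((Fintype.card V - r - j).choose (n - r) : ℝ) • ((inclusionMatrix V j r)ᵀ *ᵥ f) := by
  have hz : ∀ a, a ≠ j → inclusionMatrix V a j *ᵥ f = 0 := by
    intro a ha
    rcases lt_or_gt_of_ne ha with h | h
    · exact mem_harmonic.mp hf a h
    · rw [inclusionMatrix_eq_zero h, zero_mulVec]
  rw [mulVec_mulVec, inclusionMatrix_mul_transpose r j n hn hrj, sum_mulVec]
  simp only [smul_mulVec, ← mulVec_mulVec]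
  by_cases hj : j ≤ Fintype.card V - n
  · rw [sum_eq_single (j, Fintype.card V - n - j)]
    · simp only [inclusionMatrix_self, one_mulVec]
      congr 2
      exact Nat.choose_symm_of_eq_add (by omega)
    · rintro ⟨a, b⟩ hp hne
      rw [mem_antidiagonal] at hp
      rw [hz a, mulVec_zero, smul_zero]
      rintro rfl
      exact hne (by ext <;> simp at *; omega)
    · intro h
      exact absurd (mem_antidiagonal.mpr (by simp; omega)) h
  -- Here j exceeds v - n, so the surviving index never occurs, and the scalar vanishes too.
  · rw [Nat.choose_eq_zero_of_lt (by omega), Nat.cast_zero, zero_smul]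
    refine sum_eq_zero fun p hp => ?_
    rw [mem_antidiagonal] at hp
    rw [hz p.1 (by omega), mulVec_zero, smul_zero]

/-- The vectors induced on `t`-subsets by a function on `j`-subsets. -/
def lift {j : ℕ} (t : ℕ) (f : TSubset V j → ℝ) : TSubset V t → ℝ :=
  (inclusionMatrix V j t)ᵀ *ᵥ f

theorem transpose_inclusionMatrix_mulVec_lift {j t n : ℕ} (htn : t ≤ n) (f : TSubset V j → ℝ) :
    (inclusionMatrix V t n)ᵀ *ᵥ lift t f = ((n - j).choose (n - t) : ℝ) • lift n f := by
  rw [lift, mulVec_mulVec, ← transpose_mul, inclusionMatrix_mul _ _ _ htn, transpose_smul,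
    smul_mulVec, lift]

theorem inclusionMatrix_mulVec_lift {r j n : ℕ} (hrn : r ≤ n) (hn : n ≤ Fintype.card V)
    (hrj : r + j ≤ Fintype.card V) {f : TSubset V j → ℝ} (hf : f ∈ harmonic V j) :
    inclusionMatrix V r n *ᵥ lift n f =
      ((Fintype.card V - r - j).choose (n - r) : ℝ) • lift r f :=
  inclusionMatrix_mulVec_harmonic hrn hn hrj hf

theorem gram_mulVec_lift {r j t : ℕ} (hrt : r ≤ t) (ht : t ≤ Fintype.card V)
    (hrj : r + j ≤ Fintype.card V) {f : TSubset V j → ℝ} (hf : f ∈ harmonic V j) :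
    ((inclusionMatrix V r t)ᵀ * inclusionMatrix V r t) *ᵥ lift t f =
      (((Fintype.card V - r - j).choose (t - r) : ℝ) * ((t - j).choose (t - r) : ℝ)) •
        lift t f := by
  rw [← mulVec_mulVec, inclusionMatrix_mulVec_lift hrt ht hrj hf, mulVec_smul,
    transpose_inclusionMatrix_mulVec_lift hrt, smul_smul]

/-- Pushing the lift back down to level j returns f times C(v-2j, t-j), which is nonzero. -/
theorem lift_eq_zero {j t : ℕ} (hjt : j ≤ t) (ht : 2 * t ≤ Fintype.card V) {f : TSubset V j → ℝ}
    (hf : f ∈ harmonic V j) (h : lift t f = 0) : f = 0 := by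
  have := inclusionMatrix_mulVec_lift (n := t) hjt (by omega) (by omega) hf
  rw [h, mulVec_zero, lift, inclusionMatrix_self, transpose_one, one_mulVec] at this
  refine (smul_eq_zero.mp this.symm).resolve_left ?_
  exact Nat.cast_ne_zero.mpr (Nat.choose_pos (by omega)).ne'

/-! ### The coverage matrix acting on lifts -/

/-- The coverage matrix is the Gram matrix of the inclusions of `t`-subsets in `k`-subsets. -/
theorem coverageMatrix_eq_mul_transpose {t k : ℕ} (hk : 2 * t ≤ k) (hv : k ≤ Fintype.card V) :
    coverageMatrix V t k = inclusionMatrix V t k * (inclusionMatrix V t k)ᵀ := by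
  ext T U
  rw [inclusionMatrix_mul_transpose_apply t t k hv]
  simp only [coverageMatrix, of_apply, xi]
  have h1 : (T.1 ∪ U.1).card = t + (T.1 \ U.1).card := by
    rw [← card_sdiff_add_card, U.2, add_comm]
  have h2 : (T.1 \ U.1).card ≤ t := (card_le_card sdiff_subset).trans_eq T.2
  rw [h1, Nat.sub_sub]
  congr 1
  exact Nat.choose_symm_of_eq_add (by omega)

theorem coverageMatrix_mulVec_lift_closed {t k j : ℕ} (hk : 2 * t ≤ k) (hv : k ≤ Fintype.card V)
    (hj : j ≤ t) {f : TSubset V j → ℝ} (hf : f ∈ harmonic V j) :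
    coverageMatrix V t k *ᵥ lift t f =
      (((k - j).choose (k - t) : ℝ) * ((Fintype.card V - t - j).choose (k - t) : ℝ)) •
        lift t f := by
  rw [coverageMatrix_eq_mul_transpose hk hv, ← mulVec_mulVec,
    transpose_inclusionMatrix_mulVec_lift (by omega), mulVec_smul,
    inclusionMatrix_mulVec_lift (by omega) hv (by omega) hf, smul_smul]

/-- Binomial inversion, for the passage from intersection counts to exact intersection sizes. -/
theorem sum_alternating_choose_mul_choose {t d i : ℕ} (hi : i ≤ t) (hd : d ≤ t) :
    ∑ s ∈ range (i + 1), (-1 : ℝ) ^ (i - s) * ((t - s).choose (i - s) : ℝ) *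
      ((t - d).choose (t - s) : ℝ) = if d = i then 1 else 0 := by
  have key : ∀ s ∈ range (i + 1), (-1 : ℝ) ^ (i - s) * ((t - s).choose (i - s) : ℝ) *
      ((t - d).choose (t - s) : ℝ) =
      if d ≤ s then (-1 : ℝ) ^ (i - s) * ((i - d).choose (i - s) : ℝ) *
        ((t - d).choose (t - i) : ℝ) else 0 := by
    intro s hs
    rw [mem_range] at hs
    split_ifs with hds
    -- Trinomial revision pulls out a factor free of s, leaving an alternating sum along row i - d
    -- of Pascal's triangle.
    · have h := Nat.choose_mul (n := t - d) (k := t - s) (s := t - i) (by omega)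
      rw [show t - d - (t - i) = i - d by omega, show t - s - (t - i) = i - s by omega,
        Nat.choose_symm_of_eq_add (show t - s = (t - i) + (i - s) by omega)] at h
      have h' : ((t - d).choose (t - s) : ℝ) * ((t - s).choose (i - s) : ℝ) =
        ((t - d).choose (t - i) : ℝ) * ((i - d).choose (i - s) : ℝ) := by exact_mod_cast h
      linear_combination (-1 : ℝ) ^ (i - s) * h'
    · rw [Nat.choose_eq_zero_of_lt (show t - d < t - s by omega)]
      simp
  rw [sum_congr rfl key, ← sum_range_reflect]
  rcases le_or_gt d i with hdi | hdi
  · have h := Int.alternating_sum_range_choose (n := i - d)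
    have h' : ∑ m ∈ range (i - d + 1), (-1 : ℝ) ^ m * ((i - d).choose m : ℝ) =
        if i - d = 0 then 1 else 0 := by exact_mod_cast h
    have e : ∀ m ∈ range (i + 1), (if d ≤ i + 1 - 1 - m then
        (-1 : ℝ) ^ (i - (i + 1 - 1 - m)) * ((i - d).choose (i - (i + 1 - 1 - m)) : ℝ) *
          ((t - d).choose (t - i) : ℝ) else 0) =
        (-1 : ℝ) ^ m * ((i - d).choose m : ℝ) * ((t - d).choose (t - i) : ℝ) := by
      intro m hm
      rw [mem_range] at hm
      rw [show i - (i + 1 - 1 - m) = m by omega]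
      split_ifs with hdm
      · rfl
      · rw [Nat.choose_eq_zero_of_lt (show i - d < m by omega)]
        simp
    rw [sum_congr rfl e, ← sum_mul, ← sum_subset (range_subset_range.mpr
      (show i - d + 1 ≤ i + 1 by omega)), h']
    · by_cases hd' : d = i
      · subst hd'; simp
      · rw [if_neg hd', if_neg (by omega), zero_mul]
    · intro m _ hm
      rw [mem_range, not_lt] at hm
      rw [Nat.choose_eq_zero_of_lt (by omega)]
      simp
  · rw [if_neg (by omega)]
    refine sum_eq_zero fun m _ => if_neg (by omega)

/-- The expansion of the coverage matrix in the Gram matrices of the inclusions of smaller sets. -/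
theorem coverageMatrix_eq_sum (t k : ℕ) :
    coverageMatrix V t k = ∑ i ∈ range (t + 1), ∑ s ∈ range (i + 1),
      ((xi (Fintype.card V) t k i : ℝ) * ((-1 : ℝ) ^ (i - s) * ((t - s).choose (i - s) : ℝ))) •
        ((inclusionMatrix V (t - s) t)ᵀ * inclusionMatrix V (t - s) t) := by
  ext T U
  simp only [Matrix.sum_apply, Matrix.smul_apply, transpose_inclusionMatrix_mul_apply, smul_eq_mul]
  have hd : (T.1 \ U.1).card ≤ t := (card_le_card sdiff_subset).trans_eq T.2
  have hc : (T.1 ∩ U.1).card = t - (T.1 \ U.1).card := by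
    have := card_sdiff_add_card_inter T.1 U.1
    rw [T.2] at this
    omega
  simp only [hc, mul_assoc]
  have e : ∀ i ∈ range (t + 1), ∑ s ∈ range (i + 1), (xi (Fintype.card V) t k i : ℝ) *
      ((-1 : ℝ) ^ (i - s) * (((t - s).choose (i - s) : ℝ) *
        ((t - (T.1 \ U.1).card).choose (t - s) : ℝ))) =
      if (T.1 \ U.1).card = i then (xi (Fintype.card V) t k i : ℝ) else 0 := by
    intro i hi
    rw [mem_range] at hi
    rw [← mul_sum]
    simp only [← mul_assoc]
    rw [sum_alternating_choose_mul_choose (by omega) hd, mul_ite, mul_one, mul_zero]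
  rw [sum_congr rfl e, sum_ite_eq, if_pos (mem_range.mpr (by omega))]
  rfl

theorem coverageMatrix_mulVec_lift {t k j : ℕ} (hv : 2 * t ≤ Fintype.card V)
    (hj : j ≤ t) {f : TSubset V j → ℝ} (hf : f ∈ harmonic V j) :
    coverageMatrix V t k *ᵥ lift t f = theta (Fintype.card V) t k j • lift t f := by
  rw [coverageMatrix_eq_sum, sum_mulVec, theta, sum_smul]
  refine sum_congr rfl fun i hi => ?_
  rw [mem_range] at hi
  rw [sum_mulVec, eigenP, mul_sum, sum_smul]
  refine sum_congr rfl fun s hs => ?_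
  rw [mem_range] at hs
  rw [smul_mulVec, gram_mulVec_lift (by omega) (by omega) (by omega) hf, smul_smul,
    show t - (t - s) = s by omega,
    show Fintype.card V - (t - s) - j = Fintype.card V - t + s - j by omega]
  congr 1
  ring

/-! ### Linear algebra of eigenbases -/

theorem toMatrix_basis_eq_diagonal {n ι : Type*} [Fintype n] [DecidableEq n]
    [Fintype ι] [DecidableEq ι] {A : Matrix n n ℝ} (b : Module.Basis ι ℝ (n → ℝ)) {d : ι → ℝ}
    (h : ∀ i, A *ᵥ b i = d i • b i) :
    LinearMap.toMatrix b b (Matrix.toLin' A) = diagonal d := by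
  ext i j
  rw [LinearMap.toMatrix_apply, Matrix.toLin'_apply, h, map_smul, Finsupp.smul_apply,
    Module.Basis.repr_self, smul_eq_mul, diagonal_apply, Finsupp.single_apply]
  by_cases hij : i = j
  · simp [hij]
  · simp [hij, Ne.symm hij]

theorem charpoly_of_eigenbasis {n ι : Type*} [Fintype n] [DecidableEq n]
    [Fintype ι] [DecidableEq ι] {A : Matrix n n ℝ} (b : Module.Basis ι ℝ (n → ℝ)) {d : ι → ℝ}
    (h : ∀ i, A *ᵥ b i = d i • b i) :
    A.charpoly = ∏ i, (Polynomial.X - Polynomial.C (d i)) := by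
  rw [← Matrix.charpoly_toLin', ← LinearMap.charpoly_toMatrix _ b,
    toMatrix_basis_eq_diagonal b h, charpoly_diagonal]

theorem finrank_eigenspace_of_eigenbasis {n ι : Type*} [Fintype n] [DecidableEq n]
    [Fintype ι] [DecidableEq ι] {A : Matrix n n ℝ} (b : Module.Basis ι ℝ (n → ℝ)) {d : ι → ℝ}
    (h : ∀ i, A *ᵥ b i = d i • b i) (μ : ℝ) :
    Module.finrank ℝ (Module.End.eigenspace (Matrix.toLin' A) μ) =
      (univ.filter fun i => d i = μ).card := by
  have hd : LinearMap.toMatrix b b (Matrix.toLin' A - algebraMap ℝ _ μ) =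
      diagonal fun i => d i - μ := by
    rw [map_sub, toMatrix_basis_eq_diagonal b h, Module.algebraMap_end_eq_smul_id,
      LinearEquiv.map_smul, LinearMap.toMatrix_id, smul_one_eq_diagonal, diagonal_sub]
  have hr := rank_eq_finrank_range_toLin (diagonal fun i => d i - μ) b b
  rw [← hd, Matrix.toLin_toMatrix, hd, rank_diagonal, Fintype.card_subtype] at hr
  have hk := LinearMap.finrank_range_add_finrank_ker (Matrix.toLin' A - algebraMap ℝ _ μ)
  rw [← hr, Module.finrank_eq_card_basis b, ← card_univ,
    ← card_filter_add_card_filter_not (s := univ) (fun i => d i - μ ≠ 0)] at hk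
  rw [Module.End.eigenspace_def]
  simp only [ne_eq, not_not, sub_eq_zero] at hk
  exact Nat.add_left_cancel hk

theorem linearIndependent_sigma {M ι : Type*} [AddCommGroup M] [Module ℝ M] [Fintype ι]
    {κ : ι → Type*} [∀ i, Fintype (κ i)] {p : ι → Submodule ℝ M} (hp : iSupIndep p)
    {w : ∀ i, κ i → M} (hw : ∀ i, LinearIndependent ℝ (w i)) (hwp : ∀ i a, w i a ∈ p i) :
    LinearIndependent ℝ fun x : Σ i, κ i => w x.1 x.2 := by
  rw [Fintype.linearIndependent_iff]
  rintro c hc ⟨i, a⟩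
  rw [Fintype.sum_sigma] at hc
  have := (iSupIndep_iff_finsetSum_eq_zero_imp_eq_zero p).mp hp univ
    (fun i => ∑ a, c ⟨i, a⟩ • w i a)
    (fun i _ => Submodule.sum_mem _ fun a _ => Submodule.smul_mem _ _ (hwp i a)) hc i (mem_univ i)
  exact Fintype.linearIndependent_iff.mp (hw i) (fun a => c ⟨i, a⟩) this a

/-! ### Multiplicities and the common eigenbasis -/

theorem choose_pred_lt {v j : ℕ} (hj : 0 < j) (h : 2 * j ≤ v) :
    v.choose (j - 1) < v.choose j := by
  obtain ⟨i, rfl⟩ : ∃ i, j = i + 1 := ⟨j - 1, by omega⟩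
  have h1 := Nat.choose_succ_right_eq v i
  have h2 : 0 < v.choose i := Nat.choose_pos (by omega)
  rw [Nat.add_sub_cancel]
  by_contra hcon
  rw [not_lt] at hcon
  have h3 : v.choose i * (i + 1) < v.choose i * (v - i) :=
    Nat.mul_lt_mul_of_pos_left (by omega) h2
  have h4 : v.choose (i + 1) * (i + 1) ≤ v.choose i * (i + 1) := Nat.mul_le_mul_right _ hcon
  omega

theorem multiplicity_pos {v j : ℕ} (h : 2 * j ≤ v) : 0 < multiplicity v j := by
  rw [multiplicity]
  split_ifs with hj
  · subst hj; simp
  · have := choose_pred_lt (by omega) h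
    omega

theorem sum_multiplicity {v t : ℕ} (h : 2 * t ≤ v) :
    ∑ j ∈ range (t + 1), multiplicity v j = v.choose t := by
  induction t with
  | zero => simp [multiplicity]
  | succ t ih =>
    rw [sum_range_succ, ih (by omega), multiplicity, if_neg (Nat.succ_ne_zero t)]
    have := choose_pred_lt (Nat.succ_pos t) h
    simp only [Nat.succ_eq_add_one, Nat.add_sub_cancel] at *
    omega

theorem linearIndependent_lift {j t : ℕ} (hjt : j ≤ t) (ht : 2 * t ≤ Fintype.card V)
    {κ : Type*} {w : κ → harmonic V j} (hw : LinearIndependent ℝ w) :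
    LinearIndependent ℝ fun a => lift t (w a : TSubset V j → ℝ) := by
  let L : harmonic V j →ₗ[ℝ] TSubset V t → ℝ :=
    (inclusionMatrix V j t)ᵀ.mulVecLin ∘ₗ (harmonic V j).subtype
  have hL : LinearMap.ker L = ⊥ := by
    rw [LinearMap.ker_eq_bot']
    intro f h
    exact Subtype.ext (lift_eq_zero hjt ht f.2 h)
  exact hw.map' L hL

/-- The eigenvalues of the Gram matrix of the inclusions of `(t - 1)`-subsets in `t`-subsets. -/
def gramEigenvalue (v t j : ℕ) : ℝ :=
  ((v - (t - 1) - j).choose (t - (t - 1)) : ℝ) * ((t - j).choose (t - (t - 1)) : ℝ)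

/-- For t ≥ 1 the value is (v-t+1-j)(t-j), and both factors strictly decrease in j. For t = 0, where
t - 1 truncates, there is only one index. -/
theorem gramEigenvalue_injective {v t : ℕ} (h : 2 * t ≤ v) :
    Function.Injective fun j : Fin (t + 1) => gramEigenvalue v t j := by
  rcases Nat.eq_zero_or_pos t with rfl | ht
  · exact fun i j _ => Fin.ext (by omega)
  · refine StrictAnti.injective fun i j hij => ?_
    have hj := j.2
    have hij' : (i : ℕ) < j := hij
    simp only [gramEigenvalue, show t - (t - 1) = 1 by omega, Nat.choose_one_right]
    exact_mod_cast Nat.mul_lt_mul'' (by omega) (by omega)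

/-- There is a basis of common eigenvectors, with `multiplicity v j` of them induced by harmonic
functions on `j`-subsets. -/
theorem exists_eigenbasis {t : ℕ} (k : ℕ) (ht : 2 * t ≤ Fintype.card V) :
    ∃ b : Module.Basis (Σ j : Fin (t + 1), Fin (multiplicity (Fintype.card V) j)) ℝ
        (TSubset V t → ℝ),
      ∀ x, coverageMatrix V t k *ᵥ b x = theta (Fintype.card V) t k x.1 • b x := by
  choose w hw using fun j : Fin (t + 1) =>
    exists_linearIndependent_of_le_finrank (multiplicity_le_finrank_harmonic (V := V) (j : ℕ))
  -- Independence across levels uses the Gram matrix rather than M, since the θ_j are not known to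
  -- be distinct for small v.
  have hli := linearIndependent_sigma
    ((Module.End.eigenspaces_iSupIndep (Matrix.toLin' ((inclusionMatrix V (t - 1) t)ᵀ *
      inclusionMatrix V (t - 1) t))).comp (gramEigenvalue_injective ht))
    (fun j => linearIndependent_lift (Nat.lt_succ_iff.mp j.2) ht (hw j))
    (fun j a => by
      have hj := j.2
      rw [Function.comp_apply, Module.End.mem_eigenspace_iff, Matrix.toLin'_apply]
      exact gram_mulVec_lift (by omega) (by omega) (by omega) (w j a).2)
  refine ⟨basisOfLinearIndependentOfCardEqFinrank' _ hli ?_, fun x => ?_⟩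
  · rw [Module.finrank_fintype_fun_eq_card, card_tSubset, Fintype.card_sigma]
    simp only [Fintype.card_fin]
    rw [Fin.sum_univ_eq_sum_range, sum_multiplicity ht]
  · rw [coe_basisOfLinearIndependentOfCardEqFinrank']
    exact coverageMatrix_mulVec_lift ht (Nat.lt_succ_iff.mp x.1.2) (w x.1 x.2).2

theorem charpoly_coverageMatrix {t : ℕ} (k : ℕ) (ht : 2 * t ≤ Fintype.card V) :
    (coverageMatrix V t k).charpoly = ∏ j ∈ range (t + 1),
      (Polynomial.X - Polynomial.C (theta (Fintype.card V) t k j)) ^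
        multiplicity (Fintype.card V) j := by
  obtain ⟨b, hb⟩ := exists_eigenbasis k ht
  rw [charpoly_of_eigenbasis b hb, Fintype.prod_sigma, ← Fin.prod_univ_eq_prod_range
    (fun j => (Polynomial.X - Polynomial.C (theta (Fintype.card V) t k j)) ^
        multiplicity (Fintype.card V) j)]
  simp

theorem finrank_eigenspace_coverageMatrix {t : ℕ} (k : ℕ) (ht : 2 * t ≤ Fintype.card V) (μ : ℝ) :
    Module.finrank ℝ (Module.End.eigenspace (Matrix.toLin' (coverageMatrix V t k)) μ) =
      ∑ j ∈ (range (t + 1)).filter (fun j : ℕ => theta (Fintype.card V) t k j = μ),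
        multiplicity (Fintype.card V) j := by
  obtain ⟨b, hb⟩ := exists_eigenbasis k ht
  rw [finrank_eigenspace_of_eigenbasis b hb, card_filter, Fintype.sum_sigma, sum_filter,
    ← Fin.sum_univ_eq_sum_range
    (fun j => if theta (Fintype.card V) t k j = μ then multiplicity (Fintype.card V) j else 0)]
  refine sum_congr rfl fun j _ => ?_
  split_ifs <;> simp

theorem hasEigenvalue_coverageMatrix_iff {t : ℕ} (k : ℕ) (ht : 2 * t ≤ Fintype.card V) (μ : ℝ) :
    Module.End.HasEigenvalue (Matrix.toLin' (coverageMatrix V t k)) μ ↔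
      ∃ j ≤ t, μ = theta (Fintype.card V) t k j := by
  rw [Module.End.hasEigenvalue_iff, ne_eq, ← Submodule.finrank_eq_zero (R := ℝ),
    finrank_eigenspace_coverageMatrix k ht, sum_eq_zero_iff, not_forall]
  simp only [mem_filter, mem_range, Nat.lt_succ_iff, Classical.not_imp]
  constructor
  · rintro ⟨j, ⟨hj, rfl⟩, -⟩
    exact ⟨j, hj, rfl⟩
  · rintro ⟨j, hj, rfl⟩
    exact ⟨j, ⟨hj, rfl⟩, (multiplicity_pos (by omega)).ne'⟩

/-! ### Closed form, monotonicity and asymptotics of θ_j -/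

/-- A numerical identity proved by testing on `Fin v`: one nonzero lifted harmonic function is an
eigenvector for both expressions. -/
theorem theta_eq {v t k j : ℕ} (hk : 2 * t ≤ k) (hv : k ≤ v) (hj : j ≤ t) :
    theta v t k j = ((k - j).choose (k - t) : ℝ) * ((v - t - j).choose (k - t) : ℝ) := by
  have hpos : 0 < Module.finrank ℝ (harmonic (Fin v) j) :=
    (multiplicity_pos (by rw [Fintype.card_fin]; omega)).trans_le
      (multiplicity_le_finrank_harmonic (V := Fin v) j)
  obtain ⟨⟨f, hf⟩, hne⟩ := (Module.finrank_pos_iff_exists_ne_zero (R := ℝ)).mp hpos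
  have hne' : lift t f ≠ 0 := fun h =>
    hne (Subtype.ext (lift_eq_zero hj (by rw [Fintype.card_fin]; omega) hf h))
  have h1 := coverageMatrix_mulVec_lift (k := k) (by rw [Fintype.card_fin]; omega) hj hf
  rw [coverageMatrix_mulVec_lift_closed hk (by rw [Fintype.card_fin]; omega) hj hf] at h1
  simpa using (smul_left_injective ℝ hne' h1).symm

theorem theta_lt_theta {v t k i j : ℕ} (hk : 2 * t ≤ k) (hv : k + t ≤ v) (hij : i < j)
    (hj : j ≤ t) : theta v t k j < theta v t k i := by
  rw [theta_eq hk (by omega) hj, theta_eq hk (by omega) (by omega)]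
  have h1 : (k - j).choose (k - t) < (k - i).choose (k - t) := by
    -- k - t ≥ t > 0 because i < j ≤ t, so Pascal's rule supplies a positive increment.
    obtain ⟨c, hc⟩ : ∃ c, k - t = c + 1 := ⟨k - t - 1, by omega⟩
    calc (k - j).choose (k - t) < (k - j + 1).choose (k - t) := by
          rw [hc, Nat.choose_succ_succ']
          have : 0 < (k - j).choose c := Nat.choose_pos (by omega)
          omega
      _ ≤ (k - i).choose (k - t) := Nat.choose_le_choose _ (by omega)
  have h2 : (v - t - j).choose (k - t) ≤ (v - t - i).choose (k - t) :=
    Nat.choose_le_choose _ (by omega)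
  have h3 : 0 < (v - t - j).choose (k - t) := Nat.choose_pos (by omega)
  exact_mod_cast Nat.mul_lt_mul_of_lt_of_le h1 h2 (h3.trans_le h2)

open Filter Asymptotics in
theorem isEquivalent_choose_sub (n c : ℕ) :
    (fun v : ℕ => ((v - c).choose n : ℝ)) ~[atTop] fun v : ℕ => (v : ℝ) ^ n / (n.factorial : ℝ) := by
  have h1 := (_root_.isEquivalent_choose n).comp_tendsto (tendsto_sub_atTop_nat c)
  refine h1.trans (IsEquivalent.div (IsEquivalent.pow ?_ n) IsEquivalent.refl)
  have : (fun v : ℕ => (v : ℝ) - c) ~[atTop] fun v : ℕ => (v : ℝ) := by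
    refine IsEquivalent.sub_isLittleO IsEquivalent.refl ?_
    exact (isLittleO_const_left.mpr (Or.inr (tendsto_norm_atTop_atTop.comp
      tendsto_natCast_atTop_atTop)))
  refine (this.congr_left ?_)
  filter_upwards [eventually_ge_atTop c] with v hv
  simp [Nat.cast_sub hv]

open Filter Asymptotics in
theorem isEquivalent_theta {t k j : ℕ} (hk : 2 * t ≤ k) (hj : j ≤ t) :
    (fun v : ℕ => theta v t k j) ~[atTop] fun v : ℕ =>
      ((k - j).choose (t - j) : ℝ) * ((v : ℝ) ^ (k - t) / ((k - t).factorial : ℝ)) := by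
  have h := (IsEquivalent.refl (u := fun _ : ℕ => ((k - j).choose (t - j) : ℝ))
    (l := atTop)).mul (isEquivalent_choose_sub (k - t) (t + j))
  refine h.congr_left ?_
  filter_upwards [eventually_ge_atTop k] with v hv
  rw [theta_eq hk hv hj, Nat.choose_symm_of_eq_add (show k - j = (k - t) + (t - j) by omega),
    Nat.sub_sub]
  rfl

open Filter Asymptotics in
theorem isTheta_theta_main {t k j : ℕ} (hk : 2 * t ≤ k) :
    (fun v : ℕ => ((k - j).choose (t - j) : ℝ) *
      ((v : ℝ) ^ (k - t) / ((k - t).factorial : ℝ))) =Θ[atTop] fun v : ℕ => (v : ℝ) ^ (k - t) := by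
  have hc : ((k - j).choose (t - j) : ℝ) / ((k - t).factorial : ℝ) ≠ 0 :=
    div_ne_zero (Nat.cast_ne_zero.mpr (Nat.choose_pos (by omega)).ne')
      (Nat.cast_ne_zero.mpr (Nat.factorial_ne_zero _))
  have h := (isTheta_refl (fun v : ℕ => (v : ℝ) ^ (k - t)) atTop).const_mul_left hc
  refine (EventuallyEq.of_eq (funext fun v => ?_)).trans_isTheta h
  ring

end JohnsonCoverage

theorem proposition4p1 (t k : ℕ) (hk : 2 * t ≤ k) :
    -- the eigenvalues of `M` and their multiplicities (algebraic and geometric)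
    (∀ (V : Type*) [Fintype V] [DecidableEq V], 2 * t ≤ Fintype.card V →
      (JohnsonCoverage.coverageMatrix V t k).charpoly =
        ∏ j ∈ Finset.range (t + 1),
          (Polynomial.X - Polynomial.C (JohnsonCoverage.theta (Fintype.card V) t k j)) ^
            JohnsonCoverage.multiplicity (Fintype.card V) j ∧
      (∀ μ : ℝ,
        Module.End.HasEigenvalue
            (Matrix.toLin' (JohnsonCoverage.coverageMatrix V t k)) μ ↔
          ∃ j ≤ t, μ = JohnsonCoverage.theta (Fintype.card V) t k j) ∧
      (∀ μ : ℝ,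
        Module.finrank ℝ (Module.End.eigenspace
            (Matrix.toLin' (JohnsonCoverage.coverageMatrix V t k)) μ) =
          ∑ j ∈ (Finset.range (t + 1)).filter
              (fun j : ℕ => JohnsonCoverage.theta (Fintype.card V) t k j = μ),
            JohnsonCoverage.multiplicity (Fintype.card V) j)) ∧
    -- the asymptotics of `θ_j`, for fixed `t`, `k`, `j` and `v → ∞`
    (∀ j ≤ t, Asymptotics.IsLittleO Filter.atTop
      (fun v : ℕ => JohnsonCoverage.theta v t k j -
        ((k - j).choose (t - j) : ℝ) * ((v : ℝ) ^ (k - t) / ((k - t).factorial : ℝ)))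
      (fun v : ℕ => (v : ℝ) ^ (k - t))) ∧
    -- the `θ_j` are of order `v ^ (k - t)`
    (∀ j ≤ t, Asymptotics.IsTheta Filter.atTop
      (fun v : ℕ => JohnsonCoverage.theta v t k j) (fun v : ℕ => (v : ℝ) ^ (k - t))) ∧
    -- for large `v`: strictly decreasing in `j`, multiplicity exactly `m_j`, least one `θ_t`
    (∃ v₀ : ℕ, 2 * t ≤ v₀ ∧
      (∀ v ≥ v₀, ∀ i j : ℕ, i < j → j ≤ t →
        JohnsonCoverage.theta v t k j < JohnsonCoverage.theta v t k i) ∧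
      (∀ (V : Type*) [Fintype V] [DecidableEq V], v₀ ≤ Fintype.card V →
        (∀ j ≤ t, Module.finrank ℝ (Module.End.eigenspace
            (Matrix.toLin' (JohnsonCoverage.coverageMatrix V t k))
            (JohnsonCoverage.theta (Fintype.card V) t k j)) =
          JohnsonCoverage.multiplicity (Fintype.card V) j) ∧
        IsLeast {μ : ℝ | Module.End.HasEigenvalue
            (Matrix.toLin' (JohnsonCoverage.coverageMatrix V t k)) μ}
          (JohnsonCoverage.theta (Fintype.card V) t k t))) := by
  refine ⟨fun V _ _ hV => ⟨JohnsonCoverage.charpoly_coverageMatrix k hV,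
      JohnsonCoverage.hasEigenvalue_coverageMatrix_iff k hV,
      JohnsonCoverage.finrank_eigenspace_coverageMatrix k hV⟩,
    fun j hj => (JohnsonCoverage.isEquivalent_theta hk hj).isLittleO.trans_isTheta
      (JohnsonCoverage.isTheta_theta_main hk),
    fun j hj => (JohnsonCoverage.isEquivalent_theta hk hj).trans_isTheta
      (JohnsonCoverage.isTheta_theta_main hk),
    -- With v ≥ k + t, C(v-t-j, k-t) is positive for every j ≤ t, as strict monotonicity requires.
    k + t, by omega, fun v hv i j hij hj => JohnsonCoverage.theta_lt_theta hk hv hij hj,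
    fun V _ _ hV => ⟨fun j hj => ?_, ?_, ?_⟩⟩
  · rw [JohnsonCoverage.finrank_eigenspace_coverageMatrix k (by omega)]
    refine Finset.sum_eq_single_of_mem j (by simp; omega) fun i hi hne => ?_
    rw [Finset.mem_filter, Finset.mem_range] at hi
    rcases lt_or_gt_of_ne hne with h | h
    · exact absurd hi.2 (JohnsonCoverage.theta_lt_theta hk hV h hj).ne'
    · exact absurd hi.2 (JohnsonCoverage.theta_lt_theta hk hV h (by omega)).ne
  · exact (JohnsonCoverage.hasEigenvalue_coverageMatrix_iff k (by omega) _).mpr ⟨t, le_rfl, rfl⟩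
  · intro μ hμ
    obtain ⟨j, hj, rfl⟩ :=
      (JohnsonCoverage.hasEigenvalue_coverageMatrix_iff k (by omega) _).mp hμ
    rcases hj.lt_or_eq with h | rfl
    · exact (JohnsonCoverage.theta_lt_theta hk hV h le_rfl).le
    · exact le_rfl
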